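/- Let $\Gamma$ be a finite simplicial graph (no loops, no multiple edges) with vertex set $V$. Let $A_\Gamma=\langle V \mid vwv^{-1}w^{-1}=1 \text{ for adjacent } v,w\rangle$ be its right-angled Artin group. For $\Delta\subseteq V$ let $A_\Delta=\langle\Delta\rangle\le A_\Gamma$ be the corresponding special subgroup, which is called proper if $\Delta\neq V$. Write $\operatorname{lk}(v)$ for the set of neighbours of $v$, $\operatorname{st}(v)=\{v\}\cup\operatorname{lk}(v)$, and $v\le w$ if $\operatorname{lk}(v)\subseteq\operatorname{st}(w)$. Let $\operatorname{Out}^0(A_\Gamma)\le\operatorname{Out}(A_\Gamma)$ be the subgroup generated by the classes of all inversions ($v\mapsto v^{-1}$, other vertices fixed), all transvections ($v\mapsto vw$ for vertices $v\ne w$ with $v\le w$, other vertices fixed) and all partial conjugations ($u\mapsto vuv^{-1}$ for $u\in K$, other vertices fixed, where $K$ is a union of connected components of $\Gamma\setminus\operatorname{st}(v)$). An outer automorphism $\Phi$ stabilises a subgroup $H$ if some representative $\varphi$ of $\Phi$ satisfies $\varphi(H)=H$, and acts trivially on $H$ if some representative restricts to the identity on $H$. Let $\mathcal G,\mathcal H$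 be families of special subgroups of $A_\Gamma$, and let $O=\operatorname{Out}^0(A_\Gamma;\mathcal G,\mathcal H^t)$ be the group of all elements of $\operatorname{Out}^0(A_\Gamma)$ that stabilise every member of $\mathcal G$ and act trivially on every member of $\mathcal H$. Assume that $\mathcal G$ is saturated with respect to $(\mathcal G,\mathcal H)$, i.e. it contains every proper special subgroup that is stabilised by all elements of $O$. Write $v\le_{\mathcal G}w$ if $v\le w$ and every $A_\Delta\in\mathcal G$ with $v\in\Delta$ satisfies $w\in\Delta$; write $v\sim_{\mathcal G}w$ if $v\le_{\mathcal G}w$ and $w\le_{\mathcal G}v$, let $[v]_{\mathcal G}$ be the equivalence class of $v$, and let $T_{\mathcal G}$ be the set of these classes. The rank of $O$ is $$\operatorname{rk}(O)=\sum_{[v]_{\mathcal G}\in T_{\mathcal G}}\bigl(|[v]_{\mathcal G}|-1\bigr).$$ Then: 1. The natural homomorphism $\operatorname{Aut}(\Gamma)\to\operatorname{Out}(A_\Gamma)$, given by permuting the generators, is injective. Identify $\operatorname{Aut}(\Gamma)$ with its image and put $\operatorname{Aut}^0(\Gamma)=\operatorname{Aut}(\Gamma)\cap O$. 2. $\operatorname{Aut}^0(\Gamma)$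 is naturally isomorphic to $\prod_{[v]_{\mathcal G}\in T_{\mathcal G}}\operatorname{Sym}([v]_{\mathcal G})$: there is a group isomorphism from this direct product to $\operatorname{Aut}^0(\Gamma)$ that sends a family $(p_c)_{c\in T_{\mathcal G}}$ to the graph automorphism acting on each class $c$ as $p_c$. 3. There is a finite subset $S\subset\operatorname{Aut}^0(\Gamma)\le O$ such that $(\operatorname{Aut}^0(\Gamma),S)$ is a Coxeter system of rank $|S|=\operatorname{rk}(O)$. -/

import Mathlib

/-! ### Outer automorphism groups and relative outer automorphism groups -/

instance MulAut.conj_range_normal (A : Type*) [Group A] :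
    (MulAut.conj : A →* MulAut A).range.Normal where
  conj_mem := by
    rintro _ ⟨a, rfl⟩ φ
    refine ⟨φ a, ?_⟩
    ext x
    simp [MulAut.conj_apply]

/-- The outer automorphism group `Out(A) = Aut(A) / Inn(A)`. -/
abbrev OutAut (A : Type*) [Group A] : Type _ :=
  MulAut A ⧸ (MulAut.conj : A →* MulAut A).range

namespace OutAut

variable {A : Type*} [Group A]

/-- The outer automorphism `Φ` stabilises the subgroup `H`: some representative `φ` of `Φ`
satisfies `φ(H) = H`. -/
def Stabilises (Φ : OutAut A) (H : Subgroup A) : Prop :=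
  ∃ φ : MulAut A, (φ : OutAut A) = Φ ∧ H.map φ.toMonoidHom = H

/-- The outer automorphism `Φ` acts trivially on the subgroup `H`: some representative of `Φ`
restricts to the identity on `H`. -/
def ActsTrivially (Φ : OutAut A) (H : Subgroup A) : Prop :=
  ∃ φ : MulAut A, (φ : OutAut A) = Φ ∧ ∀ h ∈ H, φ h = h

theorem Stabilises.one (H : Subgroup A) : (1 : OutAut A).Stabilises H :=
  ⟨1, rfl, by ext x; simp [Subgroup.mem_map]⟩

theorem Stabilises.mul {Φ Ψ : OutAut A} {H : Subgroup A} (h : Φ.Stabilises H)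
    (h' : Ψ.Stabilises H) : (Φ * Ψ).Stabilises H := by
  obtain ⟨φ, rfl, hφ⟩ := h
  obtain ⟨ψ, rfl, hψ⟩ := h'
  refine ⟨φ * ψ, rfl, ?_⟩
  have e : (φ * ψ).toMonoidHom = φ.toMonoidHom.comp ψ.toMonoidHom := rfl
  rw [e, ← Subgroup.map_map, hψ, hφ]

theorem Stabilises.inv {Φ : OutAut A} {H : Subgroup A} (h : Φ.Stabilises H) :
    (Φ⁻¹).Stabilises H := by
  obtain ⟨φ, rfl, hφ⟩ := h
  refine ⟨φ⁻¹, rfl, ?_⟩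
  have e : (φ⁻¹).toMonoidHom.comp φ.toMonoidHom = MonoidHom.id A := by
    ext x
    exact φ.symm_apply_apply x
  conv_lhs => rw [← hφ]
  rw [Subgroup.map_map, e, Subgroup.map_id]

theorem ActsTrivially.one (H : Subgroup A) : (1 : OutAut A).ActsTrivially H :=
  ⟨1, rfl, fun _ _ => rfl⟩

theorem ActsTrivially.mul {Φ Ψ : OutAut A} {H : Subgroup A} (h : Φ.ActsTrivially H)
    (h' : Ψ.ActsTrivially H) : (Φ * Ψ).ActsTrivially H := by
  obtain ⟨φ, rfl, hφ⟩ := h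
  obtain ⟨ψ, rfl, hψ⟩ := h'
  refine ⟨φ * ψ, rfl, fun x hx => ?_⟩
  rw [MulAut.mul_apply, hψ x hx, hφ x hx]

theorem ActsTrivially.inv {Φ : OutAut A} {H : Subgroup A} (h : Φ.ActsTrivially H) :
    (Φ⁻¹).ActsTrivially H := by
  obtain ⟨φ, rfl, hφ⟩ := h
  refine ⟨φ⁻¹, rfl, fun x hx => ?_⟩
  conv_lhs => rw [← hφ x hx]
  exact φ.symm_apply_apply x

/-- The relative outer automorphism group `Out(A; 𝒢, ℋᵗ)`: all outer automorphisms that stabilise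
every member of `𝒢` and act trivially on every member of `ℋ`. -/
def relative (𝒢 ℋ : Set (Subgroup A)) : Subgroup (OutAut A) where
  carrier := {Φ | (∀ H ∈ 𝒢, Φ.Stabilises H) ∧ ∀ H ∈ ℋ, Φ.ActsTrivially H}
  one_mem' := ⟨fun H _ => Stabilises.one H, fun H _ => ActsTrivially.one H⟩
  mul_mem' h h' :=
    ⟨fun H hH => (h.1 H hH).mul (h'.1 H hH), fun H hH => (h.2 H hH).mul (h'.2 H hH)⟩
  inv_mem' h := ⟨fun H hH => (h.1 H hH).inv, fun H hH => (h.2 H hH).inv⟩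

end OutAut

/-! ### Right-angled Artin groups -/

/-- The right-angled Artin group `A_Γ`: generators are the vertices of `Γ`, and adjacent vertices
commute. -/
abbrev RAAG {V : Type*} (Γ : SimpleGraph V) : Type _ :=
  PresentedGroup {r : FreeGroup V | ∃ v w, Γ.Adj v w ∧
    r = FreeGroup.of v * FreeGroup.of w * (FreeGroup.of v)⁻¹ * (FreeGroup.of w)⁻¹}

namespace RAAG

variable {V : Type*} (Γ : SimpleGraph V)

/-- The generator of `A_Γ` given by a vertex. -/
abbrev gen (v : V) : RAAG Γ := PresentedGroup.of v

/-- The special subgroup `A_Δ ≤ A_Γ` of the full subgraph with vertex set `Δ`. -/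
def special (Δ : Set V) : Subgroup (RAAG Γ) := Subgroup.closure (gen Γ '' Δ)

/-- The star of a vertex: the vertex together with its link `Γ.neighborSet v`. -/
def starSet (v : V) : Set V := insert v (Γ.neighborSet v)

variable {Γ} in
/-- The endomorphism of `A_Γ` that a graph automorphism induces by permuting the generators. -/
def mapHom (σ : Γ ≃g Γ) : RAAG Γ →* RAAG Γ :=
  PresentedGroup.toGroup (f := fun v => gen Γ (σ v)) (by
    rintro _ ⟨v, w, hvw, rfl⟩
    simp only [map_mul, map_inv, FreeGroup.lift_apply_of]
    exact PresentedGroup.one_of_mem (rels := {r : FreeGroup V | ∃ v w, Γ.Adj v w ∧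
      r = FreeGroup.of v * FreeGroup.of w * (FreeGroup.of v)⁻¹ * (FreeGroup.of w)⁻¹})
      ⟨σ v, σ w, σ.map_rel_iff.2 hvw, rfl⟩)

variable {Γ} in
theorem mapHom_gen (σ : Γ ≃g Γ) (v : V) : mapHom σ (gen Γ v) = gen Γ (σ v) :=
  PresentedGroup.toGroup.of _

variable {Γ} in
theorem mapHom_mul (σ τ : Γ ≃g Γ) : mapHom (σ * τ) = (mapHom σ).comp (mapHom τ) :=
  PresentedGroup.ext fun v => by
    change mapHom (σ * τ) (gen Γ v) = mapHom σ (mapHom τ (gen Γ v))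
    rw [mapHom_gen, mapHom_gen, mapHom_gen]
    rfl

theorem mapHom_one : mapHom (1 : Γ ≃g Γ) = MonoidHom.id _ :=
  PresentedGroup.ext fun v => mapHom_gen 1 v

/-- The homomorphism `Aut(Γ) → Aut(A_Γ)`, where a graph automorphism permutes the generators. -/
def graphAut : (Γ ≃g Γ) →* MulAut (RAAG Γ) where
  toFun σ := MonoidHom.toMulEquiv (mapHom σ) (mapHom σ⁻¹)
    (by rw [← mapHom_mul, inv_mul_cancel, mapHom_one])
    (by rw [← mapHom_mul, mul_inv_cancel, mapHom_one])
  map_one' := by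
    ext x
    exact DFunLike.congr_fun (mapHom_one Γ) x
  map_mul' σ τ := by
    ext x
    exact DFunLike.congr_fun (mapHom_mul σ τ) x

theorem graphAut_gen (σ : Γ ≃g Γ) (v : V) : graphAut Γ σ (gen Γ v) = gen Γ (σ v) :=
  mapHom_gen σ v

/-- The natural homomorphism `Aut(Γ) → Out(A_Γ)`. -/
def graphOut : (Γ ≃g Γ) →* OutAut (RAAG Γ) :=
  (QuotientGroup.mk' _).comp (graphAut Γ)

/-- `φ` is the inversion at `v`. -/
def IsInversion (v : V) (φ : MulAut (RAAG Γ)) : Prop :=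
  φ (gen Γ v) = (gen Γ v)⁻¹ ∧ ∀ u, u ≠ v → φ (gen Γ u) = gen Γ u

/-- `φ` is the transvection sending `v` to `v w`, where `v ≠ w` and `v ≤ w` in the standard
ordering, i.e. the link of `v` is contained in the star of `w`. -/
def IsTransvection (v w : V) (φ : MulAut (RAAG Γ)) : Prop :=
  v ≠ w ∧ Γ.neighborSet v ⊆ starSet Γ w ∧
    φ (gen Γ v) = gen Γ v * gen Γ w ∧ ∀ u, u ≠ v → φ (gen Γ u) = gen Γ u

/-- `φ` is the partial conjugation by `v` of a union `K` of connected components of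
`Γ ∖ star(v)`. -/
def IsPartialConj (v : V) (K : Set V) (φ : MulAut (RAAG Γ)) : Prop :=
  (∃ 𝒞 : Set (Γ.induce (starSet Γ v)ᶜ).ConnectedComponent,
      K = ⋃ C ∈ 𝒞, Subtype.val '' C.supp) ∧
    (∀ u ∈ K, φ (gen Γ u) = gen Γ v * gen Γ u * (gen Γ v)⁻¹) ∧
    ∀ u, u ∉ K → φ (gen Γ u) = gen Γ u

/-- The pure outer automorphism group `Out⁰(A_Γ)`, generated by all inversions, transvections and
partial conjugations. -/
def outZero : Subgroup (OutAut (RAAG Γ)) :=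
  Subgroup.closure {Φ | ∃ φ : MulAut (RAAG Γ), (φ : OutAut (RAAG Γ)) = Φ ∧
    ((∃ v, IsInversion Γ v φ) ∨ (∃ v w, IsTransvection Γ v w φ) ∨ ∃ v K, IsPartialConj Γ v K φ)}

/-- The group `Out⁰(A_Γ; 𝒢, ℋᵗ) = Out(A_Γ; 𝒢, ℋᵗ) ∩ Out⁰(A_Γ)`. Families of special subgroups are
given by the vertex sets of the corresponding full subgraphs. -/
def relOutZero (𝒢 ℋ : Set (Set V)) : Subgroup (OutAut (RAAG Γ)) :=
  OutAut.relative (special Γ '' 𝒢) (special Γ '' ℋ) ⊓ outZero Γ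

/-- `𝒢` is saturated with respect to `(𝒢, ℋ)`: it contains every proper special subgroup that is
stabilised by `Out⁰(A_Γ; 𝒢, ℋᵗ)`. -/
def IsSaturated (𝒢 ℋ : Set (Set V)) : Prop :=
  ∀ Δ : Set V, Δ ≠ Set.univ →
    (∀ Φ ∈ relOutZero Γ 𝒢 ℋ, Φ.Stabilises (special Γ Δ)) → Δ ∈ 𝒢

/-- The `𝒢`-ordering: `v ≤ w` in the standard ordering, and every member of `𝒢` that contains `v`
also contains `w`. -/
def OrdLE (𝒢 : Set (Set V)) (v w : V) : Prop :=
  Γ.neighborSet v ⊆ starSet Γ w ∧ ∀ Δ ∈ 𝒢, v ∈ Δ → w ∈ Δ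

theorem OrdLE.refl (𝒢 : Set (Set V)) (v : V) : OrdLE Γ 𝒢 v v :=
  ⟨Set.subset_insert _ _, fun _ _ h => h⟩

variable {Γ} in
theorem OrdLE.trans {𝒢 : Set (Set V)} {u v w : V} (h : OrdLE Γ 𝒢 u v) (h' : OrdLE Γ 𝒢 v w) :
    OrdLE Γ 𝒢 u w := by
  refine ⟨fun x hx => ?_, fun Δ hΔ hu => h'.2 Δ hΔ (h.2 Δ hΔ hu)⟩
  have key : ∀ {a b : V}, OrdLE Γ 𝒢 a b → ∀ y, Γ.Adj a y → y = b ∨ Γ.Adj b y :=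
    fun hab y hy => hab.1 hy
  change x = w ∨ Γ.Adj w x
  rcases key h x hx with rfl | hvx
  · rcases key h' u hx.symm with rfl | hwu
    · exact Or.inr hx
    · rcases key h w hwu.symm with rfl | hvw
      · exact Or.inl rfl
      · exact Or.inr hvw.symm
  · exact key h' x hvx

/-- The equivalence relation `∼_𝒢` of the `𝒢`-ordering. -/
def ordSetoid (𝒢 : Set (Set V)) : Setoid V where
  r v w := OrdLE Γ 𝒢 v w ∧ OrdLE Γ 𝒢 w v
  iseqv :=
    { refl := fun v => ⟨OrdLE.refl Γ 𝒢 v, OrdLE.refl Γ 𝒢 v⟩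
      symm := fun h => ⟨h.2, h.1⟩
      trans := fun h h' => ⟨h.1.trans h'.1, h'.2.trans h.2⟩ }

/-- The set `T_𝒢` of `∼_𝒢`-equivalence classes. -/
abbrev OrdClass (𝒢 : Set (Set V)) : Type _ := Quotient (ordSetoid Γ 𝒢)

/-- The class of a vertex in `T_𝒢`. -/
abbrev cls (𝒢 : Set (Set V)) (v : V) : OrdClass Γ 𝒢 := Quotient.mk (ordSetoid Γ 𝒢) v

/-- The elements of an equivalence class. -/
abbrev ClassElems (𝒢 : Set (Set V)) (c : OrdClass Γ 𝒢) : Type _ := {v : V // cls Γ 𝒢 v = c}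

/-- The rank `rk(O) = ∑_{[v] ∈ T_𝒢} (|[v]| - 1)` of `O = Out⁰(A_Γ; 𝒢, ℋᵗ)`, where `𝒢` is saturated
and the graph is finite. -/
noncomputable def rank (𝒢 : Set (Set V)) : ℕ :=
  ∑ᶠ c : OrdClass Γ 𝒢, (Nat.card (ClassElems Γ 𝒢 c) - 1)

/-- The group `Aut⁰(Γ) = Aut(Γ) ∩ O` for `O = Out⁰(A_Γ; 𝒢, ℋᵗ)`, as a subgroup of `Out(A_Γ)`. -/
def autZero (𝒢 ℋ : Set (Set V)) : Subgroup (OutAut (RAAG Γ)) :=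
  (graphOut Γ).range ⊓ relOutZero Γ 𝒢 ℋ

end RAAG

/-- `(W, S)` is a Coxeter system, for a subset `S` of the group `W`: for some Coxeter matrix `M`
indexed by `S`, the inclusion of `S` induces an isomorphism from the Coxeter group of `M` to `W`. -/
def IsCoxeterPair (W : Type*) [Group W] (S : Set W) : Prop :=
  ∃ (M : CoxeterMatrix S) (cs : CoxeterSystem M W), ∀ s : S, cs.simple s = s

/-!
Every generator of `Out⁰(A_Γ)` preserves the normal closure of a set of vertices that is upward
closed for `≤`, and exponent sums recognise which vertices lie in such a normal closure. So a graph
automorphism `σ` whose class lies in `O` satisfies `v ≤_𝒢 σ v` for all `v`; the same for `σ⁻¹` shows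
that `σ` preserves the `∼_𝒢`-classes. Conversely any permutation of `V` preserving the classes is a
graph automorphism. It is a product of transpositions of equivalent vertices, each of which is a
product of transvections and inversions, and saturation makes the classes of vertices in members of
`ℋ` singletons, so it acts trivially on those members. Hence `Aut⁰(Γ)` is a product of symmetric
groups.

That `Sym(n + 1)` is the Coxeter group of type `A n` is proved by induction on `n`: the simple
reflections permute explicit coset representatives of the subgroup generated by all but the last of
them exactly as adjacent transpositions permute points, so the kernel of the map to `Sym(n + 1)`
lies in that subgroup.
-/

/-! ### The symmetric group as a Coxeter group of type `A` -/

/-- The defining relations of the Coxeter group of type `A n` for the first `n` terms of a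
sequence; the later terms are unconstrained, so that the notion restricts to smaller `n`. -/
structure IsBraidSeq {G : Type*} [Group G] (s : ℕ → G) (n : ℕ) : Prop where
  mul_self : ∀ i < n, s i * s i = 1
  commute : ∀ i j, i + 1 < j → j < n → Commute (s i) (s j)
  braid : ∀ i, i + 1 < n → s i * s (i + 1) * s i = s (i + 1) * s i * s (i + 1)

/-- The product `s k * s (k + 1) * ⋯ * s (n - 1)`, which is `1` for `n ≤ k`. For the adjacent
transpositions it is the cycle carrying `n` to `k`. -/
def ascProd {G : Type*} [Monoid G] (s : ℕ → G) (k n : ℕ) : G :=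
  ((List.Ico k n).map s).prod

section AscProd

variable {G : Type*} [Monoid G] {s : ℕ → G} {k m n : ℕ}

theorem ascProd_self (s : ℕ → G) (n : ℕ) : ascProd s n n = 1 := by
  rw [ascProd, List.Ico.self_empty, List.map_nil, List.prod_nil]

theorem ascProd_of_lt (h : k < n) : ascProd s k n = s k * ascProd s (k + 1) n := by
  rw [ascProd, List.Ico.eq_cons h, List.map_cons, List.prod_cons, ascProd]

theorem ascProd_mul_ascProd (hkm : k ≤ m) (hmn : m ≤ n) :
    ascProd s k m * ascProd s m n = ascProd s k n := by
  rw [ascProd, ascProd, ← List.prod_append, ← List.map_append,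
    List.Ico.append_consecutive hkm hmn, ascProd]

theorem commute_ascProd {a : G} (h : ∀ i, k ≤ i → i < n → Commute a (s i)) :
    Commute a (ascProd s k n) := by
  refine Commute.list_prod_right _ a fun x hx => ?_
  obtain ⟨i, hi, rfl⟩ := List.mem_map.1 hx
  exact h i (List.Ico.mem.1 hi).1 (List.Ico.mem.1 hi).2

end AscProd

namespace IsBraidSeq

variable {G : Type*} [Group G] {s : ℕ → G} {n : ℕ}

theorem mono (hs : IsBraidSeq s n) {m : ℕ} (h : m ≤ n) : IsBraidSeq s m where
  mul_self i hi := hs.mul_self i (hi.trans_le h)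
  commute i j hij hj := hs.commute i j hij (hj.trans_le h)
  braid i hi := hs.braid i (hi.trans_le h)

theorem inv_eq_self (hs : IsBraidSeq s n) {i : ℕ} (hi : i < n) : (s i)⁻¹ = s i :=
  inv_eq_of_mul_eq_one_right (hs.mul_self i hi)

theorem succ_mul_ascProd (hs : IsBraidSeq s n) {j k : ℕ} (hkj : k ≤ j) (hj : j + 1 < n) :
    s (j + 1) * ascProd s k n = ascProd s k n * s j := by
  have split : ascProd s k n = ascProd s k j * (s j * (s (j + 1) * ascProd s (j + 2) n)) := by
    rw [← ascProd_of_lt hj, ← ascProd_of_lt (by omega), ascProd_mul_ascProd hkj (by omega)]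
  have head : Commute (s (j + 1)) (ascProd s k j) :=
    commute_ascProd fun i _ hi => (hs.commute i (j + 1) (by omega) hj).symm
  have tail : Commute (s j) (ascProd s (j + 2) n) :=
    commute_ascProd fun i hi hin => hs.commute j i (by omega) hin
  calc s (j + 1) * ascProd s k n
      = ascProd s k j * (s (j + 1) * s j * s (j + 1)) * ascProd s (j + 2) n := by
        rw [split, ← mul_assoc, head.eq]; simp only [mul_assoc]
    _ = ascProd s k j * s j * s (j + 1) * (s j * ascProd s (j + 2) n) := by
        rw [← hs.braid j hj]; simp only [mul_assoc]
    _ = ascProd s k n * s j := by rw [tail.eq, split]; simp only [mul_assoc]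

/-- The cosets of `⟨s 0, …, s (n - 1)⟩` thus behave like the points `0, …, n + 1`, the trivial coset
being the last point. -/
theorem mk_mul_ascProd (hs : IsBraidSeq s (n + 1)) {i k : ℕ} (hi : i < n + 1) (hk : k ≤ n + 1) :
    (QuotientGroup.mk (s i * ascProd s k (n + 1)) : G ⧸ Subgroup.closure (s '' Set.Iio n)) =
      QuotientGroup.mk (ascProd s (Equiv.swap i (i + 1) k) (n + 1)) := by
  have mem {j : ℕ} (hj : j < n) : s j ∈ Subgroup.closure (s '' Set.Iio n) :=
    Subgroup.subset_closure ⟨j, hj, rfl⟩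
  rcases lt_trichotomy k i with hki | rfl | hik
  · obtain ⟨j, rfl⟩ : ∃ j, i = j + 1 := ⟨i - 1, by omega⟩
    rw [Equiv.swap_apply_of_ne_of_ne (by omega) (by omega), hs.succ_mul_ascProd (by omega) hi,
      QuotientGroup.mk_mul_of_mem _ (mem (by omega))]
  · rw [Equiv.swap_apply_left, ascProd_of_lt hi, ← mul_assoc, hs.mul_self k hi, one_mul]
  · obtain rfl | hik : k = i + 1 ∨ i + 1 < k := by omega
    · rw [Equiv.swap_apply_right, ascProd_of_lt hi]
    · have hcomm : Commute (s i) (ascProd s k (n + 1)) :=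
        commute_ascProd fun l hl hln => hs.commute i l (by omega) hln
      rw [Equiv.swap_apply_of_ne_of_ne (by omega) (by omega), hcomm.eq,
        QuotientGroup.mk_mul_of_mem _ (mem (by omega))]

section Action

variable {α : Type*} {π : G →* Equiv.Perm α} {pos : α → ℕ}

theorem mk_mul_ascProd_of_mem_closure (hs : IsBraidSeq s (n + 1))
    (hπ : ∀ i < n + 1, ∀ a, pos (π (s i) a) = Equiv.swap i (i + 1) (pos a))
    {g : G} (hg : g ∈ Subgroup.closure (s '' Set.Iio (n + 1))) {a : α} (ha : pos a ≤ n + 1) :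
    pos (π g a) ≤ n + 1 ∧
      (QuotientGroup.mk (g * ascProd s (pos a) (n + 1)) : G ⧸ Subgroup.closure (s '' Set.Iio n)) =
        QuotientGroup.mk (ascProd s (pos (π g a)) (n + 1)) := by
  let P (y : G) : Prop := pos (π y a) ≤ n + 1 ∧
    (QuotientGroup.mk (y * ascProd s (pos a) (n + 1)) : G ⧸ Subgroup.closure (s '' Set.Iio n)) =
      QuotientGroup.mk (ascProd s (pos (π y a)) (n + 1))
  change P g
  have step {i : ℕ} (hi : i < n + 1) {y : G} (hy : P y) : P (s i * y) := by
    dsimp only [P] at hy ⊢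
    rw [map_mul, Equiv.Perm.mul_apply, hπ i hi]
    constructor
    · rw [Equiv.swap_apply_def]
      split_ifs <;> omega
    · rw [← hs.mk_mul_ascProd hi hy.1, mul_assoc]
      exact congrArg (s i • ·) hy.2
  induction hg using Subgroup.closure_induction_left with
  | one => simpa only [P, map_one, Equiv.Perm.one_apply, one_mul, and_true] using ha
  | mul_left x hx y _ ih =>
    obtain ⟨i, hi, rfl⟩ := hx
    exact step hi ih
  | inv_mul_cancel x hx y _ ih =>
    obtain ⟨i, hi, rfl⟩ := hx
    rw [hs.inv_eq_self hi]
    exact step hi ih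

theorem mem_closure_of_map_apply_eq (hs : IsBraidSeq s (n + 1))
    (hπ : ∀ i < n + 1, ∀ a, pos (π (s i) a) = Equiv.swap i (i + 1) (pos a))
    {g : G} (hg : g ∈ Subgroup.closure (s '' Set.Iio (n + 1))) {a : α} (ha : pos a = n + 1)
    (hga : π g a = a) : g ∈ Subgroup.closure (s '' Set.Iio n) := by
  have mk_eq := (hs.mk_mul_ascProd_of_mem_closure hπ hg ha.le).2
  rw [hga, ha, ascProd_self, mul_one] at mk_eq
  simpa only [inv_one, one_mul] using QuotientGroup.eq.1 mk_eq.symm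

theorem eq_one_of_map_eq_one (hs : IsBraidSeq s n)
    (hπ : ∀ i < n, ∀ a, pos (π (s i) a) = Equiv.swap i (i + 1) (pos a))
    (hpos : Set.Iic n ⊆ Set.range pos) {g : G} (hg : g ∈ Subgroup.closure (s '' Set.Iio n))
    (hg1 : π g = 1) : g = 1 := by
  induction n with
  | zero =>
    rwa [← Nat.bot_eq_zero, Set.Iio_bot, Set.image_empty, Subgroup.closure_empty,
      Subgroup.mem_bot] at hg
  | succ n ih =>
    obtain ⟨a, ha⟩ := hpos (Set.mem_Iic.2 le_rfl)
    refine ih (hs.mono n.le_succ) (fun i hi => hπ i (by omega))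
      ((Set.Iic_subset_Iic.2 n.le_succ).trans hpos) ?_
    exact hs.mem_closure_of_map_apply_eq hπ hg ha (by rw [hg1, Equiv.Perm.one_apply])

end Action

end IsBraidSeq

section Simple

variable {B W : Type*} [Group W] {M : CoxeterMatrix B}

theorem commute_simple_of_eq_two (cs : CoxeterSystem M W) {i j : B} (h : M i j = 2) :
    Commute (cs.simple i) (cs.simple j) := by
  have pow_eq_one := cs.simple_mul_simple_pow i j
  rw [h, pow_two] at pow_eq_one
  have eq_inv := eq_inv_of_mul_eq_one_left pow_eq_one
  rwa [mul_inv_rev, cs.inv_simple, cs.inv_simple] at eq_inv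

theorem simple_braid_of_eq_three (cs : CoxeterSystem M W) {i j : B} (h : M i j = 3) :
    cs.simple i * cs.simple j * cs.simple i = cs.simple j * cs.simple i * cs.simple j := by
  have word_eq := cs.wordProd_braidWord_eq j i
  simp only [CoxeterSystem.braidWord, M.symmetric j i, h, CoxeterSystem.alternatingWord,
    List.concat_eq_append, List.nil_append, List.cons_append, CoxeterSystem.wordProd,
    List.map_cons, List.map_nil, List.prod_cons, List.prod_nil, mul_one] at word_eq
  simpa only [mul_assoc] using word_eq

theorem simple_ne_one (cs : CoxeterSystem M W) (i : B) : cs.simple i ≠ 1 := fun h => by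
  simpa only [h, cs.length_one, zero_ne_one] using cs.length_simple i

theorem isCoxeterPair_range_simple (cs : CoxeterSystem M W) (h : Function.Injective cs.simple) :
    IsCoxeterPair W (Set.range cs.simple) :=
  ⟨_, cs.reindex (Equiv.ofInjective _ h), fun s => by
    rw [CoxeterSystem.reindex_simple, Equiv.apply_ofInjective_symm h]⟩

end Simple

theorem isBraidSeq_of_coxeterSystem {n : ℕ} {W : Type*} [Group W]
    (cs : CoxeterSystem (CoxeterMatrix.A n) W) {s : ℕ → W}
    (hs : ∀ i : Fin n, s i = cs.simple i) : IsBraidSeq s n where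
  mul_self i hi := by rw [hs ⟨i, hi⟩, cs.simple_mul_simple_self]
  commute i j hij hj := by
    rw [hs ⟨i, by omega⟩, hs ⟨j, hj⟩]
    refine commute_simple_of_eq_two cs ?_
    change (if _ then _ else _) = _
    rw [if_neg (by simp only [Fin.mk.injEq]; omega), if_neg (by dsimp only; omega)]
  braid i hi := by
    rw [hs ⟨i, by omega⟩, hs ⟨i + 1, hi⟩]
    refine simple_braid_of_eq_three cs ?_
    change (if _ then _ else _) = _
    rw [if_neg (by simp only [Fin.mk.injEq]; omega), if_pos (by simp only [or_true])]

theorem isLiftable_swap (n : ℕ) :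
    (CoxeterMatrix.A n).IsLiftable fun i : Fin n => Equiv.swap i.castSucc i.succ := by
  intro i j
  change _ ^ (if i = j then 1 else if (j : ℕ) + 1 = i ∨ (i : ℕ) + 1 = j then 3 else 2) = _
  split_ifs with hij hadj
  · subst hij; rw [pow_one, Equiv.swap_mul_self]
  · have pow_three {a b c : Fin (n + 1)} (hab : a ≠ b) (hac : a ≠ c) (hbc : b ≠ c) :
        (Equiv.swap a b * Equiv.swap a c) ^ 3 = 1 := by
      rw [← (Equiv.Perm.isThreeCycle_swap_mul_swap_same hab hac hbc).orderOf, pow_orderOf_eq_one]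
    rcases hadj with hji | hij
    · have : i.castSucc = j.succ := Fin.ext (by simp only [Fin.val_castSucc, Fin.val_succ, hji])
      dsimp only
      rw [this, Equiv.swap_comm j.castSucc]
      apply pow_three <;> simp only [ne_eq, Fin.ext_iff, Fin.val_castSucc, Fin.val_succ] <;> omega
    · have : j.castSucc = i.succ := Fin.ext (by simp only [Fin.val_castSucc, Fin.val_succ, hij])
      dsimp only
      rw [this, Equiv.swap_comm i.castSucc]
      apply pow_three <;> simp only [ne_eq, Fin.ext_iff, Fin.val_castSucc, Fin.val_succ] <;> omega
  · have comm : Commute (Equiv.swap i.castSucc i.succ) (Equiv.swap j.castSucc j.succ) := by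
      apply Equiv.Perm.Disjoint.commute
      apply Equiv.Perm.disjoint_swap_swap
      simp only [List.nodup_cons, List.mem_cons, Fin.ext_iff, Fin.val_castSucc, Fin.val_succ,
        List.not_mem_nil, or_false, not_false_eq_true, List.nodup_nil, and_true] at *
      omega
    rw [comm.mul_pow, pow_two, pow_two, Equiv.swap_mul_self, Equiv.swap_mul_self, one_mul]

theorem lift_swap_bijective (n : ℕ) : Function.Bijective
    ((CoxeterMatrix.A n).toCoxeterSystem.lift ⟨_, isLiftable_swap n⟩) := by
  set cs := (CoxeterMatrix.A n).toCoxeterSystem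
  set π := cs.lift ⟨_, isLiftable_swap n⟩
  have hπ : ∀ i, π (cs.simple i) = Equiv.swap i.castSucc i.succ :=
    cs.lift_apply_simple (isLiftable_swap n)
  let s : ℕ → (CoxeterMatrix.A n).Group := Function.extend Fin.val cs.simple 1
  have hs (i : Fin n) : s i = cs.simple i := Fin.val_injective.extend_apply _ _ i
  constructor
  · refine (injective_iff_map_eq_one π).2 fun g hg => ?_
    refine (isBraidSeq_of_coxeterSystem cs hs).eq_one_of_map_eq_one (π := π) (pos := Fin.val)
      (fun i hi a => ?_) (fun k hk => ⟨⟨k, Nat.lt_succ_iff.2 hk⟩, rfl⟩) ?_ hg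
    · rw [hs ⟨i, hi⟩, hπ, ← Fin.val_injective.swap_apply]
      rfl
    · have range_subset : Set.range cs.simple ⊆ s '' Set.Iio n := by
        rintro _ ⟨i, rfl⟩
        exact ⟨i, i.2, hs i⟩
      refine Subgroup.closure_mono range_subset ?_
      rw [cs.subgroup_closure_range_simple]
      exact Subgroup.mem_top g
  · rw [← MonoidHom.mrange_eq_top, eq_top_iff, ← Equiv.Perm.mclosure_swap_castSucc_succ,
      Submonoid.closure_le]
    rintro _ ⟨i, rfl⟩
    exact ⟨cs.simple i, hπ i⟩

/-- The Coxeter system of type `A n` formed by the symmetric group on `n + 1` letters and its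
adjacent transpositions. -/
noncomputable def permFinCoxeterSystem (n : ℕ) :
    CoxeterSystem (CoxeterMatrix.A n) (Equiv.Perm (Fin (n + 1))) :=
  (CoxeterMatrix.A n).toCoxeterSystem.map (MulEquiv.ofBijective _ (lift_swap_bijective n))

theorem permFinCoxeterSystem_simple {n : ℕ} (i : Fin n) :
    (permFinCoxeterSystem n).simple i = Equiv.swap i.castSucc i.succ :=
  (CoxeterMatrix.A n).toCoxeterSystem.lift_apply_simple (isLiftable_swap n) i

theorem permFinCoxeterSystem_simple_injective (n : ℕ) :
    Function.Injective (permFinCoxeterSystem n).simple := fun i j hij => by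
  rw [permFinCoxeterSystem_simple, permFinCoxeterSystem_simple] at hij
  have apply_eq := Equiv.swap_apply_left i.castSucc i.succ
  rw [hij, Equiv.swap_apply_def] at apply_eq
  split_ifs at apply_eq <;> simp only [Fin.ext_iff, Fin.val_castSucc, Fin.val_succ] at * <;> omega

theorem exists_coxeterSystem_perm (α : Type*) [Finite α] [Nonempty α] :
    ∃ cs : CoxeterSystem (CoxeterMatrix.A (Nat.card α - 1)) (Equiv.Perm α),
      Function.Injective cs.simple := by
  have card_eq : Nat.card α - 1 + 1 = Nat.card α := Nat.succ_pred_eq_of_pos Nat.card_pos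
  let e : Equiv.Perm (Fin (Nat.card α - 1 + 1)) ≃* Equiv.Perm α :=
    ((finCongr card_eq).trans (Finite.equivFin α).symm).permCongrHom
  exact ⟨(permFinCoxeterSystem _).map e,
    e.injective.comp (permFinCoxeterSystem_simple_injective _)⟩

/-! ### Direct products of Coxeter systems -/

section Pi

variable {ι : Type*} [DecidableEq ι] {B : ι → Type*}

/-- The Coxeter matrix of a direct product of Coxeter groups: simple reflections of different
factors commute. -/
def sigmaCoxeterMatrix (M : ∀ i, CoxeterMatrix (B i)) : CoxeterMatrix (Σ i, B i) where
  M := Matrix.of fun x y => if h : x.1 = y.1 then M y.1 (h ▸ x.2) y.2 else 2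
  isSymm := by
    ext ⟨i, x⟩ ⟨j, y⟩
    by_cases h : i = j
    · subst h; simp [(M i).symmetric x y]
    · simp [h, Ne.symm h]
  diagonal := by rintro ⟨i, x⟩; simp
  off_diagonal := by
    rintro ⟨i, x⟩ ⟨j, y⟩ hxy
    by_cases h : i = j
    · subst h
      have : x ≠ y := fun h => hxy (by rw [h])
      simpa using (M i).off_diagonal x y this
    · simp [h]

variable (M : ∀ i, CoxeterMatrix (B i))

theorem sigmaCoxeterMatrix_same (i : ι) (x y : B i) :
    sigmaCoxeterMatrix M ⟨i, x⟩ ⟨i, y⟩ = M i x y :=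
  dif_pos rfl

theorem sigmaCoxeterMatrix_of_ne {i j : ι} (h : i ≠ j) (x : B i) (y : B j) :
    sigmaCoxeterMatrix M ⟨i, x⟩ ⟨j, y⟩ = 2 :=
  dif_neg h

theorem isLiftable_simple_sigma (i : ι) : (M i).IsLiftable fun b =>
    (sigmaCoxeterMatrix M).toCoxeterSystem.simple ⟨i, b⟩ := fun b b' => by
  rw [← sigmaCoxeterMatrix_same M, CoxeterSystem.simple_mul_simple_pow]

variable {M} {W : ι → Type*} [∀ i, Group (W i)] (cs : ∀ i, CoxeterSystem (M i) (W i))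

theorem isLiftable_mulSingle_simple : (sigmaCoxeterMatrix M).IsLiftable fun x =>
    (Pi.mulSingle x.1 ((cs x.1).simple x.2) : ∀ i, W i) := by
  rintro ⟨i, x⟩ ⟨j, y⟩
  obtain rfl | hij := eq_or_ne i j
  · rw [sigmaCoxeterMatrix_same, ← Pi.mulSingle_mul, ← Pi.mulSingle_pow,
      (cs i).simple_mul_simple_pow, Pi.mulSingle_one]
  · rw [sigmaCoxeterMatrix_of_ne M hij, (Pi.mulSingle_commute hij _ _).mul_pow,
      ← Pi.mulSingle_pow, ← Pi.mulSingle_pow, CoxeterSystem.simple_sq, CoxeterSystem.simple_sq,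
      Pi.mulSingle_one, Pi.mulSingle_one, one_mul]

/-- The inclusion of the `i`-th factor into the Coxeter group of the product. -/
noncomputable def factorHom (i : ι) : W i →* (sigmaCoxeterMatrix M).Group :=
  (cs i).lift ⟨_, isLiftable_simple_sigma M i⟩

theorem factorHom_simple (i : ι) (b : B i) :
    factorHom cs i ((cs i).simple b) = (sigmaCoxeterMatrix M).toCoxeterSystem.simple ⟨i, b⟩ :=
  (cs i).lift_apply_simple (isLiftable_simple_sigma M i) b

theorem commute_factorHom :
    Pairwise fun i j => ∀ x y, Commute (factorHom cs i x) (factorHom cs j y) := by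
  intro i j hij x y
  induction x using (cs i).simple_induction with
  | one => rw [map_one]; exact Commute.one_left _
  | mul w w' hw hw' => rw [map_mul]; exact hw.mul_left hw'
  | simple b =>
    induction y using (cs j).simple_induction with
    | one => rw [map_one]; exact Commute.one_right _
    | mul w w' hw hw' => rw [map_mul]; exact hw.mul_right hw'
    | simple b' =>
      rw [factorHom_simple, factorHom_simple]
      exact commute_simple_of_eq_two _ (sigmaCoxeterMatrix_of_ne M hij b b')

variable [Fintype ι]

/-- The direct product of finitely many Coxeter groups as a Coxeter system, whose simple
reflections are those of the factors. -/
noncomputable def piCoxeterSystem : CoxeterSystem (sigmaCoxeterMatrix M) (∀ i, W i) :=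
  let toPi := (sigmaCoxeterMatrix M).toCoxeterSystem.lift ⟨_, isLiftable_mulSingle_simple cs⟩
  let ofPi := MonoidHom.noncommPiCoprod (factorHom cs) (commute_factorHom cs)
  have toPi_simple (i) (b : B i) :
      toPi ((sigmaCoxeterMatrix M).toCoxeterSystem.simple ⟨i, b⟩) =
        Pi.mulSingle i ((cs i).simple b) :=
    CoxeterSystem.lift_apply_simple _ (isLiftable_mulSingle_simple cs) ⟨i, b⟩
  have ofPi_mulSingle (i w) : ofPi (Pi.mulSingle i w) = factorHom cs i w :=
    MonoidHom.noncommPiCoprod_mulSingle (factorHom cs) i w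
  have toPi_factorHom (i) : toPi.comp (factorHom cs i) = MonoidHom.mulSingle W i :=
    (cs i).ext_simple fun b => by
      rw [MonoidHom.comp_apply, factorHom_simple, toPi_simple, MonoidHom.mulSingle_apply]
  (sigmaCoxeterMatrix M).toCoxeterSystem.map <| MonoidHom.toMulEquiv toPi ofPi
    ((sigmaCoxeterMatrix M).toCoxeterSystem.ext_simple fun ⟨i, b⟩ => by
      rw [MonoidHom.comp_apply, toPi_simple, ofPi_mulSingle, factorHom_simple,
        MonoidHom.id_apply])
    (MonoidHom.pi_ext fun i w => by
      rw [MonoidHom.comp_apply, ofPi_mulSingle, ← MonoidHom.comp_apply, toPi_factorHom,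
        MonoidHom.mulSingle_apply, MonoidHom.id_apply])

theorem piCoxeterSystem_simple (x : Σ i, B i) :
    (piCoxeterSystem cs).simple x = Pi.mulSingle x.1 ((cs x.1).simple x.2) :=
  (sigmaCoxeterMatrix M).toCoxeterSystem.lift_apply_simple (isLiftable_mulSingle_simple cs) x

theorem piCoxeterSystem_simple_injective (h : ∀ i, Function.Injective (cs i).simple) :
    Function.Injective (piCoxeterSystem cs).simple := by
  rintro ⟨i, x⟩ ⟨j, y⟩ hxy
  rw [piCoxeterSystem_simple, piCoxeterSystem_simple] at hxy
  obtain rfl | hij := eq_or_ne i j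
  · exact congrArg _ (h i (Pi.mulSingle_injective i hxy))
  · have apply_eq := congrFun hxy i
    rw [Pi.mulSingle_eq_same, Pi.mulSingle_eq_of_ne hij] at apply_eq
    exact absurd apply_eq (simple_ne_one _ _)

end Pi

theorem exists_isCoxeterPair_pi_perm {ι : Type*} [Finite ι] (X : ι → Type*) [∀ i, Finite (X i)]
    [∀ i, Nonempty (X i)] :
    ∃ S : Set (∀ i, Equiv.Perm (X i)), S.Finite ∧ S.ncard = ∑ᶠ i, (Nat.card (X i) - 1) ∧
      IsCoxeterPair (∀ i, Equiv.Perm (X i)) S := by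
  classical
  have := Fintype.ofFinite ι
  choose cs hcs using fun i => exists_coxeterSystem_perm (X i)
  have hinj := piCoxeterSystem_simple_injective cs hcs
  refine ⟨_, Set.finite_range _, ?_, isCoxeterPair_range_simple _ hinj⟩
  rw [← Set.image_univ, Set.ncard_image_of_injective _ hinj, Set.ncard_univ, Nat.card_sigma,
    finsum_eq_sum_of_fintype]
  simp only [Nat.card_fin]

theorem isCoxeterPair_image {W W' : Type*} [Group W] [Group W'] (e : W ≃* W') {S : Set W}
    (h : IsCoxeterPair W S) : IsCoxeterPair W' (e '' S) := by
  obtain ⟨M, cs, hcs⟩ := h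
  refine ⟨_, (cs.map e).reindex (e.toEquiv.image S), fun s => ?_⟩
  rw [CoxeterSystem.reindex_simple, CoxeterSystem.map_simple, hcs]
  exact congrArg Subtype.val ((e.toEquiv.image S).apply_symm_apply s)

/-! ### Graph automorphisms in `Out⁰` preserve the equivalence classes -/

theorem OutAut.apply_mem_of_mk_eq {A : Type*} [Group A] {φ ψ : MulAut A}
    (h : (φ : OutAut A) = ψ) {N : Subgroup A} [N.Normal] {x : A} (hx : φ x ∈ N) : ψ x ∈ N := by
  obtain ⟨g, hg⟩ := QuotientGroup.eq.1 h
  have ψ_apply : ψ x = φ g * φ x * (φ g)⁻¹ := by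
    rw [eq_mul_of_inv_mul_eq hg.symm, MulAut.mul_apply, MulAut.conj_apply, map_mul, map_mul,
      map_inv]
  rw [ψ_apply]
  exact Subgroup.Normal.conj_mem ‹_› _ hx _

namespace RAAG

variable {V : Type*} {Γ : SimpleGraph V}

open Classical in
/-- The exponent sum of the vertex `u` in the elements of `A_Γ`. -/
noncomputable def expSum (Γ : SimpleGraph V) (u : V) : RAAG Γ →* Multiplicative ℤ :=
  PresentedGroup.toGroup (f := fun v => if v = u then Multiplicative.ofAdd 1 else 1) (by
    rintro _ ⟨v, w, _, rfl⟩
    rw [map_mul, map_mul, map_mul, map_inv, map_inv, mul_inv_cancel_comm, mul_inv_cancel])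

theorem expSum_gen_eq_one_iff {u v : V} : expSum Γ u (gen Γ v) = 1 ↔ v ≠ u := by
  classical
  rw [expSum, PresentedGroup.toGroup.of, ite_eq_right_iff]
  exact ⟨fun h hvu => one_ne_zero (Multiplicative.ofAdd.injective (h hvu)),
    fun h hvu => absurd hvu h⟩

theorem gen_mem_normalClosure_iff {Δ : Set V} {u : V} :
    gen Γ u ∈ Subgroup.normalClosure (gen Γ '' Δ) ↔ u ∈ Δ := by
  refine ⟨fun hmem => by_contra fun hu => ?_, fun hu => Subgroup.subset_normalClosure ⟨u, hu, rfl⟩⟩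
  have le_ker : Subgroup.normalClosure (gen Γ '' Δ) ≤ (expSum Γ u).ker := by
    refine Subgroup.normalClosure_le_normal ?_
    rintro _ ⟨v, hv, rfl⟩
    exact expSum_gen_eq_one_iff.2 fun h => hu (h ▸ hv)
  exact expSum_gen_eq_one_iff.1 (le_ker hmem) rfl

theorem apply_mem_of_graphOut_stabilises {σ : Γ ≃g Γ} {H : Subgroup (RAAG Γ)}
    (h : (graphOut Γ σ).Stabilises H) {Δ : Set V}
    (hH : H ≤ Subgroup.normalClosure (gen Γ '' Δ)) {v : V} (hv : gen Γ v ∈ H) : σ v ∈ Δ := by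
  obtain ⟨φ, hφ, hmap⟩ := h
  have φ_mem : φ (gen Γ v) ∈ H := by
    rw [← hmap]
    exact ⟨_, hv, rfl⟩
  rw [← gen_mem_normalClosure_iff (Γ := Γ), ← graphAut_gen]
  exact OutAut.apply_mem_of_mk_eq hφ (hH φ_mem)

theorem special_le_normalClosure (Δ : Set V) :
    special Γ Δ ≤ Subgroup.normalClosure (gen Γ '' Δ) :=
  Subgroup.closure_le_normalClosure

theorem gen_mem_special {Δ : Set V} {v : V} (hv : v ∈ Δ) : gen Γ v ∈ special Γ Δ :=
  Subgroup.subset_closure ⟨v, hv, rfl⟩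

theorem graphOut_injective (Γ : SimpleGraph V) : Function.Injective (graphOut Γ) := by
  refine (injective_iff_map_eq_one _).2 fun σ hσ => RelIso.ext fun v => ?_
  have stabilises : (graphOut Γ σ).Stabilises (special Γ {v}) := hσ ▸ OutAut.Stabilises.one _
  exact apply_mem_of_graphOut_stabilises stabilises (special_le_normalClosure _)
    (gen_mem_special rfl)

theorem stabilises_normalClosure {φ : MulAut (RAAG Γ)} {Δ : Set V}
    (h : ∀ u ∈ Δ, φ (gen Γ u) ∈ Subgroup.normalClosure (gen Γ '' Δ) ∧
      gen Γ u ∈ Subgroup.normalClosure (φ '' (gen Γ '' Δ))) :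
    OutAut.Stabilises (φ : OutAut (RAAG Γ)) (Subgroup.normalClosure (gen Γ '' Δ)) := by
  refine ⟨φ, rfl, ?_⟩
  rw [Subgroup.map_normalClosure _ _ φ.surjective]
  refine le_antisymm (Subgroup.normalClosure_le_normal ?_) (Subgroup.normalClosure_le_normal ?_)
  · rintro _ ⟨_, ⟨u, hu, rfl⟩, rfl⟩
    exact (h u hu).1
  · rintro _ ⟨u, hu, rfl⟩
    exact (h u hu).2

section Generators

variable {v w : V} {φ : MulAut (RAAG Γ)} {Δ : Set V}

theorem apply_gen_mem_normalClosure (φ : MulAut (RAAG Γ)) (hv : v ∈ Δ) :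
    φ (gen Γ v) ∈ Subgroup.normalClosure (φ '' (gen Γ '' Δ)) :=
  Subgroup.subset_normalClosure ⟨_, ⟨v, hv, rfl⟩, rfl⟩

theorem IsInversion.stabilises_normalClosure (h : IsInversion Γ v φ) (Δ : Set V) :
    OutAut.Stabilises (φ : OutAut (RAAG Γ)) (Subgroup.normalClosure (gen Γ '' Δ)) := by
  refine RAAG.stabilises_normalClosure fun u hu => ?_
  have mem := (gen_mem_normalClosure_iff (Γ := Γ)).2 hu
  have φ_mem := apply_gen_mem_normalClosure φ hu
  obtain rfl | huv := eq_or_ne u v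
  · rw [h.1] at φ_mem ⊢
    exact ⟨inv_mem mem, inv_mem_iff.1 φ_mem⟩
  · rw [h.2 u huv] at φ_mem ⊢
    exact ⟨mem, φ_mem⟩

theorem IsTransvection.stabilises_normalClosure (h : IsTransvection Γ v w φ)
    (hΔ : v ∈ Δ → w ∈ Δ) :
    OutAut.Stabilises (φ : OutAut (RAAG Γ)) (Subgroup.normalClosure (gen Γ '' Δ)) := by
  obtain ⟨hvw, -, φ_self, φ_of_ne⟩ := h
  refine RAAG.stabilises_normalClosure fun u hu => ?_
  have mem := (gen_mem_normalClosure_iff (Γ := Γ)).2 hu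
  have φ_mem := apply_gen_mem_normalClosure φ hu
  obtain rfl | huv := eq_or_ne u v
  · have w_mem := (gen_mem_normalClosure_iff (Γ := Γ)).2 (hΔ hu)
    have φ_w_mem := apply_gen_mem_normalClosure φ (hΔ hu)
    rw [φ_of_ne w hvw.symm] at φ_w_mem
    rw [φ_self] at φ_mem ⊢
    exact ⟨mul_mem mem w_mem, (Subgroup.mul_mem_cancel_right _ φ_w_mem).1 φ_mem⟩
  · rw [φ_of_ne u huv] at φ_mem ⊢
    exact ⟨mem, φ_mem⟩

theorem IsPartialConj.stabilises_normalClosure {K : Set V} (h : IsPartialConj Γ v K φ)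
    (Δ : Set V) :
    OutAut.Stabilises (φ : OutAut (RAAG Γ)) (Subgroup.normalClosure (gen Γ '' Δ)) := by
  obtain ⟨-, φ_of_mem, φ_of_notMem⟩ := h
  refine RAAG.stabilises_normalClosure fun u hu => ?_
  have mem := (gen_mem_normalClosure_iff (Γ := Γ)).2 hu
  have φ_mem := apply_gen_mem_normalClosure φ hu
  by_cases huK : u ∈ K
  · rw [φ_of_mem u huK] at φ_mem ⊢
    have conj_inv_mem := Subgroup.normalClosure_normal.conj_mem' _ φ_mem (gen Γ v)
    rw [mul_assoc, inv_mul_cancel_right, inv_mul_cancel_left] at conj_inv_mem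
    exact ⟨Subgroup.normalClosure_normal.conj_mem _ mem _, conj_inv_mem⟩
  · rw [φ_of_notMem u huK] at φ_mem ⊢
    exact ⟨mem, φ_mem⟩

end Generators

theorem stabilises_normalClosure_of_mem_outZero {Δ : Set V}
    (hΔ : ∀ v ∈ Δ, ∀ w, Γ.neighborSet v ⊆ starSet Γ w → w ∈ Δ) {Φ : OutAut (RAAG Γ)}
    (hΦ : Φ ∈ outZero Γ) : Φ.Stabilises (Subgroup.normalClosure (gen Γ '' Δ)) := by
  induction hΦ using Subgroup.closure_induction with
  | mem Φ hΦ =>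
    obtain ⟨φ, rfl, ⟨v, h⟩ | ⟨v, w, h⟩ | ⟨v, K, h⟩⟩ := hΦ
    · exact h.stabilises_normalClosure Δ
    · exact h.stabilises_normalClosure fun hv => hΔ v hv w h.2.1
    · exact h.stabilises_normalClosure Δ
  | one => exact OutAut.Stabilises.one _
  | mul Φ Ψ _ _ hΦ hΨ => exact hΦ.mul hΨ
  | inv Φ _ hΦ => exact hΦ.inv

theorem neighborSet_subset_of_graphOut_mem_outZero {σ : Γ ≃g Γ} (h : graphOut Γ σ ∈ outZero Γ)
    (v : V) : Γ.neighborSet v ⊆ starSet Γ (σ v) := by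
  let Δ : Set V := {u | OrdLE Γ ∅ v u}
  have hΔ : ∀ u ∈ Δ, ∀ w, Γ.neighborSet u ⊆ starSet Γ w → w ∈ Δ := fun u hu w huw =>
    hu.trans ⟨huw, fun _ h => h.elim⟩
  have hv : gen Γ v ∈ Subgroup.normalClosure (gen Γ '' Δ) :=
    gen_mem_normalClosure_iff.2 (OrdLE.refl Γ ∅ v)
  exact (apply_mem_of_graphOut_stabilises (stabilises_normalClosure_of_mem_outZero hΔ h)
    le_rfl hv).1

theorem ordLE_apply_of_graphOut_mem {𝒢 ℋ : Set (Set V)} {σ : Γ ≃g Γ}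
    (h : graphOut Γ σ ∈ relOutZero Γ 𝒢 ℋ) (v : V) : OrdLE Γ 𝒢 v (σ v) :=
  ⟨neighborSet_subset_of_graphOut_mem_outZero h.2 v, fun Δ hΔ hv =>
    apply_mem_of_graphOut_stabilises (h.1.1 _ ⟨Δ, hΔ, rfl⟩) (special_le_normalClosure Δ)
      (gen_mem_special hv)⟩

theorem cls_apply_of_graphOut_mem {𝒢 ℋ : Set (Set V)} {σ : Γ ≃g Γ}
    (h : graphOut Γ σ ∈ relOutZero Γ 𝒢 ℋ) (v : V) : cls Γ 𝒢 (σ v) = cls Γ 𝒢 v := by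
  have h_inv : graphOut Γ σ⁻¹ ∈ relOutZero Γ 𝒢 ℋ := by
    rw [map_inv]
    exact inv_mem h
  have le_inv := ordLE_apply_of_graphOut_mem h_inv (σ v)
  rw [RelIso.inv_apply_self] at le_inv
  exact Quotient.sound ⟨le_inv, ordLE_apply_of_graphOut_mem h v⟩

/-! ### Transpositions of equivalent vertices lie in `Out⁰` -/

theorem commute_gen {v w : V} (h : Γ.Adj v w) : Commute (gen Γ v) (gen Γ w) :=
  commutatorElement_eq_one_iff_commute.1 (PresentedGroup.one_of_mem
    (rels := {r : FreeGroup V | ∃ v w, Γ.Adj v w ∧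
      r = FreeGroup.of v * FreeGroup.of w * (FreeGroup.of v)⁻¹ * (FreeGroup.of w)⁻¹})
    ⟨v, w, h, rfl⟩)

theorem commute_gen_of_mem_starSet {v w : V} (h : v ∈ starSet Γ w) :
    Commute (gen Γ w) (gen Γ v) := by
  obtain rfl | hwv := h
  · exact Commute.refl _
  · exact commute_gen hwv

section Update

variable {v w : V} {g g' : RAAG Γ}

open Classical in
/-- The endomorphism of `A_Γ` that sends `v` to `g` and fixes the other vertices. -/
noncomputable def updateHom (v : V) (g : RAAG Γ)
    (hg : ∀ u, Γ.Adj v u → Commute g (gen Γ u)) : RAAG Γ →* RAAG Γ :=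
  PresentedGroup.toGroup (f := Function.update (gen Γ) v g) (by
    rintro _ ⟨a, b, hab, rfl⟩
    simp only [map_mul, map_inv, FreeGroup.lift_apply_of, Function.update_apply]
    rw [← commutatorElement_def, commutatorElement_eq_one_iff_commute]
    split_ifs with ha hb hb
    · exact Commute.refl g
    · exact hg b (ha ▸ hab)
    · exact (hg a (hb ▸ hab.symm)).symm
    · exact commute_gen hab)

theorem updateHom_gen_self (hg : ∀ u, Γ.Adj v u → Commute g (gen Γ u)) :
    updateHom v g hg (gen Γ v) = g := by
  classical
  rw [updateHom, PresentedGroup.toGroup.of, Function.update_self]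

theorem updateHom_gen_of_ne {u : V} (hg : ∀ u, Γ.Adj v u → Commute g (gen Γ u)) (h : u ≠ v) :
    updateHom v g hg (gen Γ u) = gen Γ u := by
  classical
  rw [updateHom, PresentedGroup.toGroup.of, Function.update_of_ne h]

/-- The automorphism `φ` of `A_Γ` sends `v` to `g` and fixes the other vertices; this is the
common shape of inversions and transvections. -/
def IsUpdate (v : V) (g : RAAG Γ) (φ : MulAut (RAAG Γ)) : Prop :=
  φ (gen Γ v) = g ∧ ∀ u, u ≠ v → φ (gen Γ u) = gen Γ u

theorem exists_isUpdate (hg : ∀ u, Γ.Adj v u → Commute g (gen Γ u))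
    (hg' : ∀ u, Γ.Adj v u → Commute g' (gen Γ u)) (h : updateHom v g hg g' = gen Γ v)
    (h' : updateHom v g' hg' g = gen Γ v) :
    ∃ φ : MulAut (RAAG Γ), IsUpdate v g φ ∧ IsUpdate v g' φ⁻¹ := by
  have comp_eq_id {a b : RAAG Γ} (ha : ∀ u, Γ.Adj v u → Commute a (gen Γ u))
      (hb : ∀ u, Γ.Adj v u → Commute b (gen Γ u)) (hab : updateHom v a ha b = gen Γ v) :
      (updateHom v a ha).comp (updateHom v b hb) = MonoidHom.id _ := by
    refine PresentedGroup.ext fun u => ?_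
    change updateHom v a ha (updateHom v b hb (gen Γ u)) = gen Γ u
    obtain rfl | huv := eq_or_ne u v
    · rw [updateHom_gen_self, hab]
    · rw [updateHom_gen_of_ne hb huv, updateHom_gen_of_ne ha huv]
  exact ⟨MonoidHom.toMulEquiv (updateHom v g hg) (updateHom v g' hg') (comp_eq_id hg' hg h')
    (comp_eq_id hg hg' h), ⟨updateHom_gen_self hg, fun _ => updateHom_gen_of_ne hg⟩,
    ⟨updateHom_gen_self hg', fun _ => updateHom_gen_of_ne hg'⟩⟩

theorem exists_isUpdate_inv_mem_outZero (v : V) : ∃ φ : MulAut (RAAG Γ),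
    IsUpdate v (gen Γ v)⁻¹ φ ∧ (φ : OutAut (RAAG Γ)) ∈ outZero Γ := by
  have hc (u : V) (hu : Γ.Adj v u) : Commute (gen Γ v)⁻¹ (gen Γ u) := (commute_gen hu).inv_left
  have apply_inv : updateHom v _ hc (gen Γ v)⁻¹ = gen Γ v := by
    rw [map_inv, updateHom_gen_self, inv_inv]
  obtain ⟨φ, hφ, -⟩ := exists_isUpdate hc hc apply_inv apply_inv
  exact ⟨φ, hφ, Subgroup.subset_closure ⟨φ, rfl, Or.inl ⟨v, hφ⟩⟩⟩

theorem exists_isUpdate_mul_mem_outZero (hvw : v ≠ w) (h : Γ.neighborSet v ⊆ starSet Γ w) :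
    ∃ φ : MulAut (RAAG Γ), IsUpdate v (gen Γ v * gen Γ w) φ ∧
      IsUpdate v (gen Γ v * (gen Γ w)⁻¹) φ⁻¹ ∧ (φ : OutAut (RAAG Γ)) ∈ outZero Γ := by
  have hw (u : V) (hu : Γ.Adj v u) : Commute (gen Γ w) (gen Γ u) :=
    commute_gen_of_mem_starSet (h hu)
  have hg (u : V) (hu : Γ.Adj v u) := (commute_gen hu).mul_left (hw u hu)
  have hg' (u : V) (hu : Γ.Adj v u) := (commute_gen hu).mul_left (hw u hu).inv_left
  obtain ⟨φ, hφ, hφ'⟩ := exists_isUpdate hg hg'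
    (by rw [map_mul, map_inv, updateHom_gen_self, updateHom_gen_of_ne hg hvw.symm,
      mul_inv_cancel_right])
    (by rw [map_mul, updateHom_gen_self, updateHom_gen_of_ne hg' hvw.symm, inv_mul_cancel_right])
  exact ⟨φ, hφ, hφ', Subgroup.subset_closure ⟨φ, rfl, Or.inr (Or.inl ⟨v, w, hvw, h, hφ⟩)⟩⟩

theorem exists_isUpdate_mul_left_mem_outZero (hvw : v ≠ w)
    (h : Γ.neighborSet v ⊆ starSet Γ w) : ∃ φ : MulAut (RAAG Γ),
      IsUpdate v (gen Γ w * gen Γ v) φ ∧ (φ : OutAut (RAAG Γ)) ∈ outZero Γ := by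
  obtain ⟨ι, hι, ι_mem⟩ := exists_isUpdate_inv_mem_outZero (Γ := Γ) v
  obtain ⟨τ, -, hτ', τ_mem⟩ := exists_isUpdate_mul_mem_outZero hvw h
  refine ⟨ι * τ⁻¹ * ι, ⟨?_, fun u hu => ?_⟩, mul_mem (mul_mem ι_mem (inv_mem τ_mem)) ι_mem⟩
  · simp only [MulAut.mul_apply, hι.1, hτ'.1, hι.2 w hvw.symm, map_inv, map_mul, mul_inv_rev,
      inv_inv]
  · simp only [MulAut.mul_apply, hι.2 u hu, hτ'.2 u hu]

theorem graphOut_mem_outZero_of_eq_swap [DecidableEq V] {σ : Γ ≃g Γ}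
    (hσ : ∀ u, σ u = Equiv.swap v w u) (hvw : v ≠ w) (h : Γ.neighborSet v ⊆ starSet Γ w)
    (h' : Γ.neighborSet w ⊆ starSet Γ v) : graphOut Γ σ ∈ outZero Γ := by
  obtain ⟨κ, hκ, κ_mem⟩ := exists_isUpdate_inv_mem_outZero (Γ := Γ) w
  obtain ⟨l, hl, l_mem⟩ := exists_isUpdate_mul_left_mem_outZero hvw h
  obtain ⟨ρ, -, hρ', ρ_mem⟩ := exists_isUpdate_mul_mem_outZero hvw.symm h'
  obtain ⟨τ, hτ, -, τ_mem⟩ := exists_isUpdate_mul_mem_outZero hvw h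
  -- The pair `(v, w)` becomes `(v, w⁻¹)`, `(w * v, w⁻¹)`, `(w, v * w⁻¹)` and `(w, v)` in turn.
  have graphAut_eq : graphAut Γ σ = τ * ρ⁻¹ * l * κ := by
    refine MulEquiv.toMonoidHom_injective (PresentedGroup.ext fun u => ?_)
    change graphAut Γ σ (gen Γ u) = (τ * ρ⁻¹ * l * κ) (gen Γ u)
    rw [graphAut_gen, hσ]
    simp only [MulAut.mul_apply]
    obtain rfl | huv := eq_or_ne u v
    · rw [Equiv.swap_apply_left, hκ.2 u hvw, hl.1, map_mul, hρ'.1, hρ'.2 u hvw,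
        inv_mul_cancel_right, hτ.2 w hvw.symm]
    obtain rfl | huw := eq_or_ne u w
    · rw [Equiv.swap_apply_right, hκ.1, map_inv, hl.2 u huv, map_inv, hρ'.1, mul_inv_rev, inv_inv,
        map_mul, map_inv, hτ.1, hτ.2 u huv, mul_inv_cancel_right]
    · rw [Equiv.swap_apply_of_ne_of_ne huv huw, hκ.2 u huw, hl.2 u huv, hρ'.2 u huw, hτ.2 u huv]
  change ((graphAut Γ σ : MulAut (RAAG Γ)) : OutAut (RAAG Γ)) ∈ outZero Γ
  rw [graphAut_eq]
  exact mul_mem (mul_mem (mul_mem τ_mem (inv_mem ρ_mem)) l_mem) κ_mem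

end Update

end RAAG

/-! ### Permutations of the fibres of a map -/

section FiberPerm

variable {α β : Type*} (f : α → β)

/-- A family of permutations of the fibres of `f`, as a permutation of the domain of `f`. -/
def fiberPermHom : (∀ b, Equiv.Perm {a // f a = b}) →* Equiv.Perm α :=
  (Equiv.sigmaFiberEquiv f).permCongrHom.toMonoidHom.comp (Equiv.Perm.sigmaCongrRightHom _)

theorem fiberPermHom_apply (p : ∀ b, Equiv.Perm {a // f a = b}) (a : α) :
    fiberPermHom f p a = p (f a) ⟨a, rfl⟩ :=
  rfl

theorem fiberPermHom_injective : Function.Injective (fiberPermHom f) :=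
  (Equiv.sigmaFiberEquiv f).permCongrHom.injective.comp Equiv.Perm.sigmaCongrRightHom_injective

theorem map_fiberPermHom_apply (p : ∀ b, Equiv.Perm {a // f a = b}) (a : α) :
    f (fiberPermHom f p a) = f a :=
  (p (f a) ⟨a, rfl⟩).2

theorem exists_fiberPermHom_eq {f : α → β} {σ : Equiv.Perm α} (h : ∀ a, f (σ a) = f a) :
    ∃ p, fiberPermHom f p = σ :=
  ⟨fun b => σ.subtypePerm fun a => by rw [h], Equiv.ext fun _ => rfl⟩

theorem fiberPermHom_mulSingle_swap [DecidableEq α] [DecidableEq β] {b : β}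
    (x y : {a // f a = b}) :
    fiberPermHom f (Pi.mulSingle b (Equiv.swap x y)) = Equiv.swap (x : α) y := by
  ext a
  rw [fiberPermHom_apply]
  by_cases ha : f a = b
  · subst ha
    rw [Pi.mulSingle_eq_same]
    simp only [Equiv.swap_apply_def, Subtype.ext_iff]
    split_ifs <;> rfl
  · rw [Pi.mulSingle_eq_of_ne ha, Equiv.Perm.one_apply, Equiv.swap_apply_of_ne_of_ne]
    · exact fun h => ha (h ▸ x.2)
    · exact fun h => ha (h ▸ y.2)

end FiberPerm

namespace RAAG

variable {V : Type*} {Γ : SimpleGraph V} {𝒢 ℋ : Set (Set V)}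

/-! ### The group `Aut⁰(Γ)` -/

theorem adj_of_ordLE {v w v' w' : V} (h : Γ.Adj v w) (hv : OrdLE Γ 𝒢 v v')
    (hw : OrdLE Γ 𝒢 w w') (hne : v' ≠ w') : Γ.Adj v' w' := by
  obtain rfl | hv'w : w = v' ∨ Γ.Adj v' w := hv.1 h
  · obtain rfl | hw'v : v = w' ∨ Γ.Adj w' v := hw.1 h.symm
    · exact h.symm
    · exact (hv.1 hw'v.symm).resolve_left hne.symm
  · exact ((hw.1 hv'w.symm).resolve_left hne).symm

theorem ordLE_of_cls_eq {v w : V} (h : cls Γ 𝒢 v = cls Γ 𝒢 w) : OrdLE Γ 𝒢 v w :=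
  (Quotient.exact h : (ordSetoid Γ 𝒢).r v w).1

theorem adj_apply_iff_of_cls_apply {σ : Equiv.Perm V} (h : ∀ v, cls Γ 𝒢 (σ v) = cls Γ 𝒢 v)
    {v w : V} : Γ.Adj (σ v) (σ w) ↔ Γ.Adj v w :=
  ⟨fun hvw => adj_of_ordLE hvw (ordLE_of_cls_eq (h v)) (ordLE_of_cls_eq (h w))
      fun heq => hvw.ne (congrArg σ heq),
    fun hvw => adj_of_ordLE hvw (ordLE_of_cls_eq (h v).symm) (ordLE_of_cls_eq (h w).symm)
      fun heq => hvw.ne (σ.injective heq)⟩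

/-- A family of permutations of the `∼_𝒢`-classes, as an automorphism of `Γ`. -/
def classAut (Γ : SimpleGraph V) (𝒢 : Set (Set V)) :
    (∀ c, Equiv.Perm (ClassElems Γ 𝒢 c)) →* (Γ ≃g Γ) where
  toFun p := ⟨fiberPermHom (cls Γ 𝒢) p, adj_apply_iff_of_cls_apply (map_fiberPermHom_apply _ p)⟩
  map_one' := RelIso.ext fun v => DFunLike.congr_fun (map_one (fiberPermHom (cls Γ 𝒢))) v
  map_mul' p q := RelIso.ext fun v => DFunLike.congr_fun (map_mul (fiberPermHom (cls Γ 𝒢)) p q) v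

theorem cls_classAut_apply (p : ∀ c, Equiv.Perm (ClassElems Γ 𝒢 c)) (v : V) :
    cls Γ 𝒢 (classAut Γ 𝒢 p v) = cls Γ 𝒢 v :=
  map_fiberPermHom_apply _ p v

theorem classAut_injective (Γ : SimpleGraph V) (𝒢 : Set (Set V)) :
    Function.Injective (classAut Γ 𝒢) := fun _ _ h =>
  fiberPermHom_injective _ (congrArg RelIso.toEquiv h)

theorem exists_classAut_eq {σ : Γ ≃g Γ} (h : ∀ v, cls Γ 𝒢 (σ v) = cls Γ 𝒢 v) :
    ∃ p, classAut Γ 𝒢 p = σ := by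
  obtain ⟨p, hp⟩ := exists_fiberPermHom_eq (σ := σ.toEquiv) h
  exact ⟨p, RelIso.ext fun v => DFunLike.congr_fun hp v⟩

theorem graphOut_classAut_mem_outZero [Finite V] (p : ∀ c, Equiv.Perm (ClassElems Γ 𝒢 c)) :
    graphOut Γ (classAut Γ 𝒢 p) ∈ outZero Γ := by
  classical
  change p ∈ (outZero Γ).comap ((graphOut Γ).comp (classAut Γ 𝒢))
  refine Subgroup.pi_mem_of_mulSingle_mem p fun c => ?_
  induction p c using Equiv.Perm.swap_induction_on with
  | one =>
    rw [Pi.mulSingle_one]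
    exact one_mem _
  | swap_mul f x y hxy ih =>
    rw [Pi.mulSingle_mul]
    refine mul_mem ?_ ih
    have hcls : cls Γ 𝒢 (x : V) = cls Γ 𝒢 y := x.2.trans y.2.symm
    exact graphOut_mem_outZero_of_eq_swap
      (fun u => DFunLike.congr_fun (fiberPermHom_mulSingle_swap (cls Γ 𝒢) x y) u)
      (Subtype.coe_ne_coe.2 hxy) (ordLE_of_cls_eq hcls).1 (ordLE_of_cls_eq hcls.symm).1

theorem graphOut_stabilises {σ : Γ ≃g Γ} {Δ : Set V} (h : σ '' Δ = Δ) :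
    (graphOut Γ σ).Stabilises (special Γ Δ) := by
  refine ⟨graphAut Γ σ, rfl, ?_⟩
  have image_image : graphAut Γ σ '' (gen Γ '' Δ) = gen Γ '' (σ '' Δ) := by
    simp only [Set.image_image, graphAut_gen]
  rw [special, MonoidHom.map_closure]
  exact congrArg Subgroup.closure (image_image.trans (by rw [h]))

theorem graphOut_actsTrivially {σ : Γ ≃g Γ} {Δ : Set V} (h : ∀ v ∈ Δ, σ v = v) :
    (graphOut Γ σ).ActsTrivially (special Γ Δ) := by
  refine ⟨graphAut Γ σ, rfl, ?_⟩
  have eqOn : Set.EqOn (graphAut Γ σ).toMonoidHom (MonoidHom.id _) (special Γ Δ) := by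
    refine MonoidHom.eqOn_closure ?_
    rintro _ ⟨v, hv, rfl⟩
    exact (graphAut_gen Γ σ v).trans (congrArg (gen Γ) (h v hv))
  exact eqOn

theorem image_eq_of_cls_apply {σ : Γ ≃g Γ} (h : ∀ v, cls Γ 𝒢 (σ v) = cls Γ 𝒢 v) {Δ : Set V}
    (hΔ : Δ ∈ 𝒢) : σ '' Δ = Δ := by
  have apply_mem_iff (v : V) : σ v ∈ Δ ↔ v ∈ Δ :=
    ⟨(ordLE_of_cls_eq (h v)).2 Δ hΔ, (ordLE_of_cls_eq (h v).symm).2 Δ hΔ⟩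
  conv_lhs => rw [← Set.ext apply_mem_iff]
  exact Set.image_preimage_eq Δ σ.surjective

theorem graphOut_mem_relOutZero_iff [Finite V]
    (hℋ : ∀ Δ ∈ ℋ, ∀ v ∈ Δ, ∀ w, cls Γ 𝒢 w = cls Γ 𝒢 v → w = v) {σ : Γ ≃g Γ} :
    graphOut Γ σ ∈ relOutZero Γ 𝒢 ℋ ↔ ∀ v, cls Γ 𝒢 (σ v) = cls Γ 𝒢 v := by
  refine ⟨cls_apply_of_graphOut_mem, fun h => ⟨⟨?_, ?_⟩, ?_⟩⟩
  · rintro _ ⟨Δ, hΔ, rfl⟩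
    exact graphOut_stabilises (image_eq_of_cls_apply h hΔ)
  · rintro _ ⟨Δ, hΔ, rfl⟩
    exact graphOut_actsTrivially fun v hv => hℋ Δ hΔ v hv _ (h v)
  · obtain ⟨p, rfl⟩ := exists_classAut_eq h
    exact graphOut_classAut_mem_outZero p

/-- The isomorphism from the product of the symmetric groups of the `∼_𝒢`-classes to
`Aut⁰(Γ) = Aut(Γ) ∩ O`, available when the classes of the vertices in members of `ℋ` are
singletons. -/
noncomputable def classPermEquiv [Finite V]
    (hℋ : ∀ Δ ∈ ℋ, ∀ v ∈ Δ, ∀ w, cls Γ 𝒢 w = cls Γ 𝒢 v → w = v) :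
    (∀ c, Equiv.Perm (ClassElems Γ 𝒢 c)) ≃* autZero Γ 𝒢 ℋ :=
  MulEquiv.ofBijective
    (((graphOut Γ).comp (classAut Γ 𝒢)).codRestrict (autZero Γ 𝒢 ℋ) fun p =>
      ⟨⟨_, rfl⟩, (graphOut_mem_relOutZero_iff hℋ).2 (cls_classAut_apply p)⟩) <| by
    refine ⟨fun p q h => classAut_injective Γ 𝒢 (graphOut_injective Γ (congrArg Subtype.val h)), ?_⟩
    rintro ⟨_, ⟨σ, rfl⟩, hσ⟩
    obtain ⟨p, rfl⟩ := exists_classAut_eq (cls_apply_of_graphOut_mem hσ)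
    exact ⟨p, rfl⟩

theorem eq_of_mem_of_cls_eq (hsat : IsSaturated Γ 𝒢 ℋ) {Δ : Set V} (hΔ : Δ ∈ ℋ) {v w : V}
    (hv : v ∈ Δ) (h : cls Γ 𝒢 w = cls Γ 𝒢 v) : w = v := by
  by_cases huniv : ({v} : Set V) = Set.univ
  · exact huniv.ge (Set.mem_univ w)
  have singleton_mem : {v} ∈ 𝒢 := by
    refine hsat {v} huniv fun Φ hΦ => ?_
    obtain ⟨φ, hφ, fixes⟩ := hΦ.1.2 _ ⟨Δ, hΔ, rfl⟩
    refine ⟨φ, hφ, ?_⟩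
    rw [special, Set.image_singleton, MonoidHom.map_closure, Set.image_singleton]
    exact congrArg (fun x => Subgroup.closure {x}) (fixes _ (gen_mem_special hv))
  exact (ordLE_of_cls_eq h.symm).2 _ singleton_mem rfl

end RAAG

theorem mainTheorem10_general {V : Type*} [Finite V] (Γ : SimpleGraph V) (𝒢 ℋ : Set (Set V))
    (hℋ : ∀ Δ ∈ ℋ, ∀ v ∈ Δ, ∀ w, RAAG.cls Γ 𝒢 w = RAAG.cls Γ 𝒢 v → w = v) :
    Function.Injective (RAAG.graphOut Γ) ∧
    (∃ e : (∀ c : RAAG.OrdClass Γ 𝒢, Equiv.Perm (RAAG.ClassElems Γ 𝒢 c)) ≃*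
        RAAG.autZero Γ 𝒢 ℋ,
      ∀ p : ∀ c : RAAG.OrdClass Γ 𝒢, Equiv.Perm (RAAG.ClassElems Γ 𝒢 c),
        ∃ σ : Γ ≃g Γ, RAAG.graphOut Γ σ = (e p : OutAut (RAAG Γ)) ∧
          ∀ v : V, σ v = (p (RAAG.cls Γ 𝒢 v) ⟨v, rfl⟩ : V)) ∧
    ∃ S : Set (RAAG.autZero Γ 𝒢 ℋ),
      S.Finite ∧ S.ncard = RAAG.rank Γ 𝒢 ∧ IsCoxeterPair (RAAG.autZero Γ 𝒢 ℋ) S := by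
  let e := RAAG.classPermEquiv hℋ
  refine ⟨RAAG.graphOut_injective Γ, ⟨e, fun p => ⟨RAAG.classAut Γ 𝒢 p, rfl, fun _ => rfl⟩⟩, ?_⟩
  have class_nonempty (c) : Nonempty (RAAG.ClassElems Γ 𝒢 c) := nonempty_subtype.2 c.exists_rep
  obtain ⟨S, S_finite, S_ncard, hS⟩ := exists_isCoxeterPair_pi_perm (RAAG.ClassElems Γ 𝒢)
  exact ⟨e '' S, S_finite.image e, (Set.ncard_image_of_injective S e.injective).trans S_ncard,
    isCoxeterPair_image e hS⟩

theorem mainTheorem10 {V : Type*} [Finite V] (Γ : SimpleGraph V) (𝒢 ℋ : Set (Set V))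
    (hsat : RAAG.IsSaturated Γ 𝒢 ℋ) :
    Function.Injective (RAAG.graphOut Γ) ∧
    (∃ e : (∀ c : RAAG.OrdClass Γ 𝒢, Equiv.Perm (RAAG.ClassElems Γ 𝒢 c)) ≃*
        RAAG.autZero Γ 𝒢 ℋ,
      ∀ p : ∀ c : RAAG.OrdClass Γ 𝒢, Equiv.Perm (RAAG.ClassElems Γ 𝒢 c),
        ∃ σ : Γ ≃g Γ, RAAG.graphOut Γ σ = (e p : OutAut (RAAG Γ)) ∧
          ∀ v : V, σ v = (p (RAAG.cls Γ 𝒢 v) ⟨v, rfl⟩ : V)) ∧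
    ∃ S : Set (RAAG.autZero Γ 𝒢 ℋ),
      S.Finite ∧ S.ncard = RAAG.rank Γ 𝒢 ∧ IsCoxeterPair (RAAG.autZero Γ 𝒢 ℋ) S :=
  mainTheorem10_general Γ 𝒢 ℋ fun _ hΔ _ hv _ => RAAG.eq_of_mem_of_cls_eq hsat hΔ hv
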